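/- A function $f:\mathbb{N}^*\to\mathbb{C}$ on the positive integers is called CMO (completely multiplicative with sum zero) if it is not identically zero, if $f(ab)=f(a)f(b)$ for all integers $a,b\ge 1$, and if $\sum_{n=1}^{\infty}f(n)=0$, in the sense that the partial sums $\sum_{n=1}^{N}f(n)$ converge to $0$ as $N\to+\infty$. (i) Let $\lambda$ be the Liouville function, that is, the completely multiplicative function with $\lambda(p)=-1$ for every prime $p$ (and $\lambda(1)=1$). Then the function $n\mapsto \lambda(n)/n$ is CMO; in particular $\sum_{n=1}^{\infty}\lambda(n)/n$ converges and its sum is $0$. (ii) Let $\chi$ be a non-principal Dirichlet character modulo some integer $q\ge 1$, let $L_\chi$ be its Dirichlet $L$-function (the analytic continuation of $\sum_{n=1}^{\infty}\chi(n)n^{-s}$), and let $\rho$ be a complex number with $\operatorname{Re}\rho>0$ and $L_\chi(\rho)=0$. Then the function $n\mapsto \chi(n)/n^{\rho}$ is CMO. -/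

import Mathlib

/-- A function `f` from the positive integers to `ℂ` is `CMO` (completely multiplicative with
sum zero) if it is not identically zero, satisfies `f (a * b) = f a * f b` for all `a`, `b`, and
the sequence of its partial sums `f 1 + ... + f N` converges to `0` as `N` tends to infinity. -/
structure IsCMO (f : ℕ+ → ℂ) : Prop where
  ne_zero : f ≠ 0
  map_mul : ∀ a b : ℕ+, f (a * b) = f a * f b
  tendsto_sum : Filter.Tendsto (fun N : ℕ => ∑ k ∈ Finset.range N, f k.succPNat)
    Filter.atTop (nhds 0)

/-!
Both parts rest on Abel summation: if the partial sums of `c` are bounded, then for `Re s > 0` the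
series `∑ c(n) n⁻ˢ` converges to `s` times the Mellin transform at `-s` of the summatory function
`t ↦ ∑_{n ≤ t} c(n)` (`tendsto_sum_mul_cpow_of_bounded`), which is holomorphic in that half plane.

For a non-principal character `χ` the partial sums are bounded by periodicity, so the identity
theorem extends `L(s, χ) = ∑ χ(n) n⁻ˢ` from `Re s > 1` to `Re s > 0`
(`tendsto_sum_dirichletCharacter_mul_cpow`). At a zero of the `L`-function the sum is `0`.

The statement `∑ λ(n) / n = 0` has the strength of the prime number theorem. Let
`P(t) = ∑_{n ≤ t} λ(n) / n`. Since `∑_{d ∣ n} λ(d)` lies in `{0, 1}`, elementary counting gives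
`|P| ≤ 2` (`abs_sum_liouville_div_le`). By Abel summation and Euler products the Mellin transform of
`P` at `-z` is `ζ(2 + 2z) / (z ζ(1 + z))` for `Re z > 0`. The pole of `ζ` at `1` cancels the factor
`z`, and `ζ` has no zeros on the line `Re s = 1`, so this extends continuously to `Re z ≥ 0`.

The passage to `P(t) → 0` is a Tauberian theorem (`tendsto_zero_of_mellin_continuousOn`). In the
variable `u = -log t` the Mellin transform is a Fourier transform; moving it onto a Schwartz
kernel whose Fourier transform has compact support and letting `Re z → 0`, the averages of `P`
against translates of the kernel become Fourier integrals of a continuous function with compact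
support, which tend to `0` by the Riemann-Lebesgue lemma. As `P` oscillates slowly
(`norm_summatory_exp_sub_le`), narrow averages are uniformly close to `P` itself.
-/

open Filter Topology MeasureTheory Set
open ArithmeticFunction hiding log
open scoped FourierTransform SchwartzMap ContDiff ArithmeticFunction.zeta

/-! ### Dirichlet series with bounded partial sums -/

/-- The summatory function `t ↦ ∑ c k` over the integers `1 ≤ k ≤ t`. -/
noncomputable def summatory (c : ℕ → ℂ) (t : ℝ) : ℂ := ∑ k ∈ Finset.Icc 1 ⌊t⌋₊, c k

theorem summatory_of_lt_one (c : ℕ → ℂ) {t : ℝ} (ht : t < 1) : summatory c t = 0 := by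
  simp [summatory, Nat.floor_eq_zero.mpr ht]

theorem measurable_summatory (c : ℕ → ℂ) : Measurable (summatory c) :=
  (measurable_from_nat (f := fun n : ℕ => ∑ k ∈ Finset.Icc 1 n, c k)).comp Nat.measurable_floor

theorem norm_summatory_le {c : ℕ → ℂ} {C : ℝ} (hC : ∀ n : ℕ, ‖∑ k ∈ Finset.Icc 1 n, c k‖ ≤ C)
    (t : ℝ) : ‖summatory c t‖ ≤ C := hC _

theorem locallyIntegrable_of_measurable_of_norm_le {P : ℝ → ℂ} (hP : Measurable P) {C : ℝ}
    (hC : ∀ t, ‖P t‖ ≤ C) : LocallyIntegrable P :=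
  (locallyIntegrable_const C).mono hP.aestronglyMeasurable
    (.of_forall fun t => (hC t).trans (Real.le_norm_self C))

/-- If `P` is bounded and vanishes on `(-∞, 1)`, its Mellin transform is holomorphic on the left
half plane. -/
theorem differentiableAt_mellin_of_bounded {P : ℝ → ℂ} (hP : Measurable P) {C : ℝ}
    (hC : ∀ t, ‖P t‖ ≤ C) (h0 : ∀ t < 1, P t = 0) {s : ℂ} (hs : s.re < 0) :
    DifferentiableAt ℂ (mellin P) s := by
  refine mellin_differentiableAt_of_isBigO_rpow (a := 0) (b := s.re - 1)
    ((locallyIntegrable_of_measurable_of_norm_le hP hC).locallyIntegrableOn _) ?_ hs ?_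
    (by linarith)
  · exact .of_bound C (.of_forall fun t => by simpa using hC t)
  · refine (Asymptotics.isBigO_zero _ _).congr' ?_ .rfl
    filter_upwards [nhdsWithin_le_nhds (Iio_mem_nhds one_pos)] with t ht using (h0 t ht).symm

theorem mellin_eq_integral_Ioi_one {P : ℝ → ℂ} (h0 : ∀ t < 1, P t = 0) (s : ℂ) :
    mellin P s = ∫ t in Ioi (1 : ℝ), (t : ℂ) ^ (s - 1) • P t := by
  rw [mellin, ← integral_Ici_eq_integral_Ioi (x := (1 : ℝ))]
  refine (setIntegral_eq_of_subset_of_forall_sdiff_eq_zero measurableSet_Ioi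
    (fun t (ht : 1 ≤ t) => one_pos.trans_le ht) fun t ht => ?_)
  simp [h0 t (not_le.mp ht.2)]

/-- A Dirichlet series whose coefficients have bounded partial sums converges on `Re s > 0`, and
its sum is given by Abel summation as a Mellin transform. -/
theorem tendsto_sum_mul_cpow_of_bounded {c : ℕ → ℂ} (hc : c 0 = 0) {C : ℝ}
    (hC : ∀ n : ℕ, ‖∑ k ∈ Finset.Icc 1 n, c k‖ ≤ C) {s : ℂ} (hs : 0 < s.re) :
    Tendsto (fun n : ℕ => ∑ k ∈ Finset.Icc 1 n, c k * (k : ℂ) ^ (-s)) atTop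
      (𝓝 (s * mellin (summatory c) (-s))) := by
  have hs0 : -s ≠ 0 := by
    intro h
    rw [neg_eq_zero] at h
    simp [h] at hs
  have hsum (n : ℕ) : ∑ k ∈ Finset.Icc 0 n, c k = ∑ k ∈ Finset.Icc 1 n, c k := by
    rw [Finset.Icc_eq_cons_Ioc (Nat.zero_le _), Finset.sum_cons, hc, zero_add]; rfl
  simp_rw [mul_comm (c _)]
  have hS : (fun t : ℝ => ∑ k ∈ Finset.Icc 0 ⌊t⌋₊, c k) = summatory c := funext fun t => hsum _
  have hI (n : ℕ) : ∑ k ∈ Finset.Icc 1 n, (k : ℂ) ^ (-s) * c k =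
      ∑ k ∈ Finset.Icc 0 n, ((k : ℝ) : ℂ) ^ (-s) * c k := by
    rw [Finset.Icc_eq_cons_Ioc (Nat.zero_le n), Finset.sum_cons, hc, mul_zero, zero_add]; rfl
  simp_rw [hI]
  convert! tendsto_sum_mul_atTop_nhds_one_sub_integral₀ (f := fun x : ℝ => (x : ℂ) ^ (-s)) (l := 0)
    (g := fun t : ℝ => t ^ (-s.re - 1)) c hc ?_ ?_ ?_ ?_ ?_ using 2
  · rw [zero_sub, ← integral_neg, mellin_eq_integral_Ioi_one fun t => summatory_of_lt_one c,
      ← integral_const_mul]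
    refine setIntegral_congr_fun measurableSet_Ioi fun t ht => ?_
    simp only [hsum]
    rw [Complex.deriv_ofReal_cpow_const (zero_lt_one.trans ht).ne' hs0, summatory, smul_eq_mul]
    ring
  · exact fun t ht => differentiableAt_id.ofReal_cpow_const (zero_lt_one.trans_le ht).ne' hs0
  · exact (Iff.mpr integrableOn_Ici_iff_integrableOn_Ioi <|
      integrableOn_Ioi_deriv_ofReal_cpow zero_lt_one (by simpa using hs)).locallyIntegrableOn
  · have hlim : Tendsto (fun n : ℕ => (n : ℝ) ^ (-s.re)) atTop (𝓝 0) :=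
      (tendsto_rpow_neg_atTop hs).comp tendsto_natCast_atTop_atTop
    have hlim' : Tendsto (fun n : ℕ => ((n : ℝ) : ℂ) ^ (-s)) atTop (𝓝 0) := by
      refine (Asymptotics.IsBigO.trans_tendsto ?_ hlim)
      exact Asymptotics.isBigO_norm_left.mp
        (Complex.norm_ofReal_cpow_eventually_eq_atTop _).isBigO.natCast_atTop
    simp_rw [hsum]
    exact hlim'.zero_mul_isBoundedUnder_le ⟨C, by simpa using ⟨0, fun n _ => hC n⟩⟩
  · have h1 := isBigO_deriv_ofReal_cpow_const_atTop (-s)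
    have h2 : (fun t : ℝ => ∑ k ∈ Finset.Icc 0 ⌊t⌋₊, c k) =O[atTop] fun _ => (1 : ℝ) := by
      rw [hS]
      exact .of_bound C (.of_forall fun t => by simpa using norm_summatory_le hC t)
    simpa using h1.mul h2
  · exact integrableAtFilter_rpow_atTop_iff.mpr (by linarith)

theorem LSeries_eq_mul_mellin_summatory {c : ℕ → ℂ} (hc : c 0 = 0) {C : ℝ}
    (hC : ∀ n : ℕ, ‖∑ k ∈ Finset.Icc 1 n, c k‖ ≤ C) {s : ℂ} (hs : 0 < s.re)
    (hS : LSeriesSummable c s) : LSeries c s = s * mellin (summatory c) (-s) := by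
  refine tendsto_nhds_unique ((tendsto_add_atTop_iff_nat 1).mpr hS.hasSum.tendsto_sum_nat) ?_
  refine (tendsto_sum_mul_cpow_of_bounded hc hC hs).congr fun n => ?_
  rw [Finset.range_eq_Ico, Finset.sum_eq_sum_Ico_succ_bot n.succ_pos, LSeries.term_zero, zero_add]
  simp_rw [LSeries.term_def₀ hc]
  rfl

/-- Coefficients with bounded partial sums: if the absolutely convergent Dirichlet series agrees
far to the right with a function holomorphic on `Re s > 0`, the partial sums converge to that
function on all of `Re s > 0`. -/
theorem tendsto_sum_mul_cpow_of_analytic_continuation {c : ℕ → ℂ} (hc : c 0 = 0) {C : ℝ}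
    (hC : ∀ n : ℕ, ‖∑ k ∈ Finset.Icc 1 n, c k‖ ≤ C) {L : ℂ → ℂ} (hL : Differentiable ℂ L)
    (hS : ∀ s : ℂ, 1 < s.re → LSeriesSummable c s) (hLS : ∀ s : ℂ, 1 < s.re → L s = LSeries c s)
    {s : ℂ} (hs : 0 < s.re) :
    Tendsto (fun n : ℕ => ∑ k ∈ Finset.Icc 1 n, c k * (k : ℂ) ^ (-s)) atTop (𝓝 (L s)) := by
  have hU : IsOpen {z : ℂ | 0 < z.re} := isOpen_lt continuous_const Complex.continuous_re
  have hF : AnalyticOnNhd ℂ (fun s => s * mellin (summatory c) (-s)) {z : ℂ | 0 < z.re} := by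
    refine DifferentiableOn.analyticOnNhd (fun z hz => ?_) hU
    have h := differentiableAt_mellin_of_bounded (measurable_summatory c) (norm_summatory_le hC)
      (fun t => summatory_of_lt_one c) (s := -z) (by simpa using hz)
    exact (differentiableAt_id.mul
      (h.comp z differentiableAt_id.neg)).differentiableWithinAt
  have hLa : AnalyticOnNhd ℂ L {z : ℂ | 0 < z.re} := hL.differentiableOn.analyticOnNhd hU
  have heq := hLa.eqOn_of_preconnected_of_eventuallyEq hF
    (convex_halfSpace_re_gt 0).isPreconnected (z₀ := 2) (by simp) (by
      filter_upwards [(isOpen_lt continuous_const Complex.continuous_re).mem_nhds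
        (show (2 : ℂ) ∈ {z : ℂ | 1 < z.re} by simp)] with z hz
      have hz' : 1 < z.re := hz
      rw [hLS z hz', LSeries_eq_mul_mellin_summatory hc hC (by linarith) (hS z hz')])
  rw [heq hs]
  exact tendsto_sum_mul_cpow_of_bounded hc hC hs

/-! ### Series of non-principal Dirichlet characters -/

theorem exists_norm_sum_dirichletCharacter_le {q : ℕ} [NeZero q] {χ : DirichletCharacter ℂ q}
    (hχ : χ ≠ 1) : ∃ C : ℝ, ∀ n : ℕ, ‖∑ k ∈ Finset.range n, χ (k : ZMod q)‖ ≤ C := by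
  have h0 : ∑ k ∈ Finset.range q, χ (k : ZMod q) = 0 := by
    rw [← MulChar.sum_eq_zero_of_ne_one hχ]
    refine Finset.sum_bij (fun k _ => (k : ZMod q)) (by simp) ?_ ?_ (by simp)
    · intro a ha b hb h
      rw [ZMod.natCast_eq_natCast_iff] at h
      exact h.eq_of_lt_of_lt (Finset.mem_range.mp ha) (Finset.mem_range.mp hb)
    · exact fun b _ => ⟨b.val, Finset.mem_range.mpr b.val_lt, by simp⟩
  have hper : Function.Periodic (fun n : ℕ => ∑ k ∈ Finset.range n, χ (k : ZMod q)) q := by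
    intro n
    simp only [add_comm n q, Finset.sum_range_add, h0, zero_add, Nat.cast_add, CharP.cast_eq_zero]
  refine ⟨∑ m ∈ Finset.range q, ‖∑ k ∈ Finset.range m, χ (k : ZMod q)‖, fun n => ?_⟩
  rw [← hper.map_mod_nat n]
  exact Finset.single_le_sum
    (f := fun m => ‖∑ k ∈ Finset.range m, χ (k : ZMod q)‖) (fun _ _ => norm_nonneg _)
    (Finset.mem_range.mpr (n.mod_lt (NeZero.pos q)))

theorem tendsto_sum_dirichletCharacter_mul_cpow {q : ℕ} [NeZero q] {χ : DirichletCharacter ℂ q}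
    (hχ : χ ≠ 1) {s : ℂ} (hs : 0 < s.re) :
    Tendsto (fun n : ℕ => ∑ k ∈ Finset.Icc 1 n, χ (k : ZMod q) * (k : ℂ) ^ (-s)) atTop
      (𝓝 (χ.LFunction s)) := by
  have hq : q ≠ 1 := by
    rintro rfl
    exact hχ (Subsingleton.elim _ _)
  have hc : χ ((0 : ℕ) : ZMod q) = 0 := by
    have : Fact (1 < q) := ⟨by have := NeZero.ne q; omega⟩
    simpa using! χ.map_zero
  obtain ⟨C, hC⟩ := exists_norm_sum_dirichletCharacter_le hχ
  refine tendsto_sum_mul_cpow_of_analytic_continuation (c := fun k : ℕ => χ (k : ZMod q)) hc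
    (C := C) (fun n => ?_)
    (DirichletCharacter.differentiable_LFunction hχ)
    (fun s hs => DirichletCharacter.LSeriesSummable_of_one_lt_re χ hs)
    (fun s hs => DirichletCharacter.LFunction_eq_LSeries χ hs) hs
  have := hC (n + 1)
  rw [Finset.range_eq_Ico, Finset.sum_eq_sum_Ico_succ_bot n.succ_pos, hc, zero_add] at this
  exact this

/-! ### A Tauberian theorem for Mellin transforms -/

theorem integral_fourier_mul_eq_flip {f g : ℝ → ℂ} (hf : Integrable f) (hg : Integrable g) :
    ∫ y, 𝓕 f y * g y = ∫ u, f u * 𝓕 g u := by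
  simpa using! VectorFourier.integral_fourierIntegral_smul_eq_flip (L := innerₗ ℝ)
    Real.continuous_fourierChar continuous_inner hf hg

theorem fourier_fourierChar_mul (φ : ℝ → ℂ) (T u : ℝ) :
    𝓕 (fun y => (𝐞 (T * y) : ℂ) * φ y) u = 𝓕 φ (u - T) := by
  rw [Real.fourier_real_eq, Real.fourier_real_eq]
  refine integral_congr_ae (.of_forall fun y => ?_)
  simp only [Circle.smul_def, smul_eq_mul]
  rw [← mul_assoc, ← Circle.coe_mul, ← AddChar.map_add_eq_mul]
  congr 3
  ring

/-- The Fourier form of the Mellin transform in logarithmic coordinates. -/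
theorem fourier_exp_mul_eq_mellin (P : ℝ → ℂ) (σ y : ℝ) :
    𝓕 (fun u : ℝ => (Real.exp (σ * u) : ℂ) * P (Real.exp (-u))) y =
      mellin P (-(σ - 2 * Real.pi * y * Complex.I)) := by
  rw [mellin_eq_fourier]
  have : (-(σ - 2 * Real.pi * y * Complex.I) : ℂ).im / (2 * Real.pi) = y := by
    simp
  rw [this]
  refine congrArg (fun f : ℝ → ℂ => 𝓕 f y) (funext fun u => ?_)
  simp

theorem integrable_exp_mul_comp_exp_neg {P : ℝ → ℂ} (hP : Measurable P) {C : ℝ}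
    (hC : ∀ t, ‖P t‖ ≤ C) (h0 : ∀ t < 1, P t = 0) {σ : ℝ} (hσ : 0 < σ) :
    Integrable (fun u : ℝ => (Real.exp (σ * u) : ℂ) * P (Real.exp (-u))) := by
  have h1 : IntegrableOn (fun u : ℝ => C * Real.exp (σ * u)) (Iic 0) :=
    (integrableOn_exp_mul_Iic hσ 0).const_mul C
  refine (h1.integrable_indicator measurableSet_Iic).mono' ?_ (.of_forall fun u => ?_)
  · exact (by fun_prop : Measurable fun u : ℝ =>
      (Real.exp (σ * u) : ℂ) * P (Real.exp (-u))).aestronglyMeasurable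
  · by_cases hu : u ≤ 0
    · rw [indicator_of_mem (show u ∈ Iic 0 from hu), norm_mul, mul_comm, Complex.norm_real,
        Real.norm_of_nonneg (Real.exp_nonneg _)]
      gcongr
      exact hC _
    · have : Real.exp (-u) < 1 := by simpa using hu
      simp [h0 _ this, indicator, hu]

/-- The flip formula for Fourier integrals on the boundary `Re z = 0`, obtained as the limit of the
same formula on `Re z = σ > 0`, where the factor `exp (σ u)` makes the integrals converge. -/
theorem integral_comp_exp_neg_mul_fourier {P : ℝ → ℂ} (hP : Measurable P) {C : ℝ}
    (hC : ∀ t, ‖P t‖ ≤ C) (h0 : ∀ t < 1, P t = 0) {H : ℂ → ℂ}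
    (hH : ContinuousOn H {z | 0 ≤ z.re}) (hPH : ∀ z : ℂ, 0 < z.re → mellin P (-z) = H z)
    {ψ : ℝ → ℂ} (hψ : Continuous ψ) (hψc : HasCompactSupport ψ) (hψi : Integrable (𝓕 ψ)) :
    ∫ u : ℝ, P (Real.exp (-u)) * 𝓕 ψ u =
      ∫ y : ℝ, H (-(2 * Real.pi * y * Complex.I)) * ψ y := by
  have hflip {σ : ℝ} (hσ : 0 < σ) :
      ∫ u : ℝ, (Real.exp (σ * u) : ℂ) * P (Real.exp (-u)) * 𝓕 ψ u =
        ∫ y : ℝ, H (σ - 2 * Real.pi * y * Complex.I) * ψ y := by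
    rw [← integral_fourier_mul_eq_flip (integrable_exp_mul_comp_exp_neg hP hC h0 hσ)
      (hψ.integrable_of_hasCompactSupport hψc)]
    refine integral_congr_ae (.of_forall fun y => ?_)
    simp only
    rw [fourier_exp_mul_eq_mellin, hPH _ (by simpa using hσ)]
  have hleft : Tendsto (fun σ : ℝ => ∫ u : ℝ, (Real.exp (σ * u) : ℂ) * P (Real.exp (-u)) * 𝓕 ψ u)
      (𝓝[>] 0) (𝓝 (∫ u : ℝ, P (Real.exp (-u)) * 𝓕 ψ u)) := by
    refine tendsto_integral_filter_of_dominated_convergence (fun u => C * ‖𝓕 ψ u‖) ?_ ?_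
      (hψi.norm.const_mul C) (.of_forall fun u => ?_)
    · exact .of_forall fun σ => ((by fun_prop : Measurable fun u : ℝ =>
        (Real.exp (σ * u) : ℂ) * P (Real.exp (-u))).aestronglyMeasurable).mul
          hψi.aestronglyMeasurable
    · filter_upwards [self_mem_nhdsWithin] with σ hσ
      refine .of_forall fun u => ?_
      rw [norm_mul]
      gcongr
      by_cases hu : u ≤ 0
      · rw [norm_mul, Complex.norm_real, Real.norm_of_nonneg (Real.exp_nonneg _)]
        have : Real.exp (σ * u) ≤ 1 :=
          Real.exp_le_one_iff.mpr (mul_nonpos_of_nonneg_of_nonpos (le_of_lt hσ) hu)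
        nlinarith [hC (Real.exp (-u)), norm_nonneg (P (Real.exp (-u)))]
      · have : Real.exp (-u) < 1 := by simpa using hu
        simpa [h0 _ this] using (norm_nonneg _).trans (hC 0)
    · have : Continuous fun σ : ℝ => (Real.exp (σ * u) : ℂ) * P (Real.exp (-u)) * 𝓕 ψ u := by
        fun_prop
      simpa using (this.tendsto 0).mono_left nhdsWithin_le_nhds
  have hright : Tendsto (fun σ : ℝ => ∫ y : ℝ, H (σ - 2 * Real.pi * y * Complex.I) * ψ y)
      (𝓝[>] 0) (𝓝 (∫ y : ℝ, H (-(2 * Real.pi * y * Complex.I)) * ψ y)) := by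
    have hcont : ContinuousOn (fun p : ℝ × ℝ => H (p.1 - 2 * Real.pi * p.2 * Complex.I))
        (Icc 0 1 ×ˢ univ) :=
      hH.comp (by fun_prop) fun p hp => by simpa using hp.1.1
    obtain ⟨M, hM⟩ := ((isCompact_Icc (a := (0 : ℝ)) (b := 1)).prod hψc).exists_bound_of_continuousOn
      (hcont.mono (prod_mono_right (subset_univ _)))
    have hslice (σ : ℝ) (hσ : 0 ≤ σ) :
        Continuous fun y : ℝ => H (σ - 2 * Real.pi * y * Complex.I) * ψ y :=
      (hH.comp_continuous (by fun_prop) fun y => by simpa using hσ).mul hψ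
    have hIoc : Ioc (0 : ℝ) 1 ∈ 𝓝[>] (0 : ℝ) := Ioc_mem_nhdsGT one_pos
    refine tendsto_integral_filter_of_dominated_convergence (fun y => M * ‖ψ y‖) ?_ ?_
      ((hψ.integrable_of_hasCompactSupport hψc).norm.const_mul M) (.of_forall fun y => ?_)
    · filter_upwards [hIoc] with σ hσ using (hslice σ hσ.1.le).aestronglyMeasurable
    · filter_upwards [hIoc] with σ hσ
      refine .of_forall fun y => ?_
      by_cases hy : y ∈ tsupport ψ
      · rw [norm_mul]
        gcongr
        exact hM (σ, y) ⟨⟨hσ.1.le, hσ.2⟩, hy⟩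
      · simp [image_eq_zero_of_notMem_tsupport hy]
    · have h1 : ContinuousWithinAt (fun σ : ℝ => H (σ - 2 * Real.pi * y * Complex.I) * ψ y)
          (Ici 0) 0 :=
        ((hH.comp (by fun_prop) fun σ (hσ : 0 ≤ σ) => by simpa using hσ).mul
          continuousOn_const) 0 self_mem_Ici
      have h2 := h1.tendsto.mono_left (nhdsWithin_mono 0 Ioi_subset_Ici_self)
      simpa using h2
  refine tendsto_nhds_unique hleft (hright.congr' ?_)
  filter_upwards [self_mem_nhdsWithin] with σ hσ using (hflip hσ).symm

/-- The smoothed form of the Tauberian theorem: averages of `u ↦ P (exp (-u))` against translates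
of a kernel with compactly supported Fourier transform tend to `0`, by the Riemann-Lebesgue
lemma. -/
theorem tendsto_integral_comp_exp_neg_add_mul_fourier {P : ℝ → ℂ} (hP : Measurable P) {C : ℝ}
    (hC : ∀ t, ‖P t‖ ≤ C) (h0 : ∀ t < 1, P t = 0) {H : ℂ → ℂ}
    (hH : ContinuousOn H {z | 0 ≤ z.re}) (hPH : ∀ z : ℂ, 0 < z.re → mellin P (-z) = H z)
    {φ : ℝ → ℂ} (hφ : Continuous φ) (hφc : HasCompactSupport φ) (hφi : Integrable (𝓕 φ)) :
    Tendsto (fun T : ℝ => ∫ v : ℝ, P (Real.exp (-(T + v))) * 𝓕 φ v) atBot (𝓝 0) := by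
  have key (T : ℝ) : ∫ v : ℝ, P (Real.exp (-(T + v))) * 𝓕 φ v =
      𝓕 (fun y : ℝ => H (-(2 * Real.pi * y * Complex.I)) * φ y) (-T) := by
    have hψ := integral_comp_exp_neg_mul_fourier hP hC h0 hH hPH
      (ψ := fun y => (𝐞 (T * y) : ℂ) * φ y) (by fun_prop) hφc.mul_left (by
        simpa only [funext (fourier_fourierChar_mul φ T)] using hφi.comp_sub_right T)
    simp only [fourier_fourierChar_mul] at hψ
    rw [← integral_sub_right_eq_self _ T]
    simp only [add_sub_cancel]
    rw [hψ, Real.fourier_real_eq]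
    refine integral_congr_ae (.of_forall fun y => ?_)
    simp only [Circle.smul_def, smul_eq_mul]
    rw [show -(y * -T) = T * y by ring]
    ring
  simp_rw [key]
  exact (Real.zero_at_infty_fourier _).comp
    (tendsto_neg_atBot_atTop.mono_right atTop_le_cocompact)

/-- A Schwartz function with integral `1` and compactly supported Fourier transform, presented as
the Fourier transform of a bump function. -/
theorem exists_schwartz_integral_fourier_eq_one :
    ∃ φ : 𝓢(ℝ, ℂ), HasCompactSupport φ ∧ ∫ v, 𝓕 (φ : ℝ → ℂ) v = 1 := by
  let b : ContDiffBump (0 : ℝ) := ⟨1, 2, one_pos, one_lt_two⟩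
  have hc : HasCompactSupport fun y : ℝ => (b y : ℂ) :=
    b.hasCompactSupport.comp_left (g := fun x : ℝ => (x : ℂ)) Complex.ofReal_zero
  have hd : ContDiff ℝ ∞ fun y : ℝ => (b y : ℂ) := Complex.ofRealCLM.contDiff.comp b.contDiff
  refine ⟨hc.toSchwartzMap hd, hc, ?_⟩
  set φ := hc.toSchwartzMap hd
  have h1 : 𝓕⁻ (𝓕 (φ : ℝ → ℂ)) 0 = φ 0 := by
    rw [φ.continuous.fourierInv_fourier_eq φ.integrable (𝓕 φ).integrable]
  rw [Real.fourierInv_eq] at h1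
  have h2 : φ 0 = 1 := by
    have : b (0 : ℝ) = 1 := b.one_of_mem_closedBall (by simp [b])
    change (b (0 : ℝ) : ℂ) = 1
    simp [this]
  simpa [h2] using h1

/-- The Tauberian theorem. Let `P` be bounded, zero on `(-∞, 1)` and slowly oscillating, and let its
Mellin transform extend continuously to the imaginary axis. Then `P` tends to `0` at infinity. -/
theorem tendsto_zero_of_mellin_continuousOn {P : ℝ → ℂ} (hP : Measurable P) {C : ℝ}
    (hC : ∀ t, ‖P t‖ ≤ C) (h0 : ∀ t < 1, P t = 0) {H : ℂ → ℂ}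
    (hH : ContinuousOn H {z | 0 ≤ z.re}) (hPH : ∀ z : ℂ, 0 < z.re → mellin P (-z) = H z)
    {K : ℝ} {η : ℝ → ℝ} (hη : Tendsto η atBot (𝓝 0))
    (hosc : ∀ T u : ℝ, ‖P (Real.exp (-(T + u))) - P (Real.exp (-T))‖ ≤ K * |u| + η T) :
    Tendsto P atTop (𝓝 0) := by
  obtain ⟨φ, hφc, hφ1⟩ := exists_schwartz_integral_fourier_eq_one
  have hki : Integrable (𝓕 (φ : ℝ → ℂ)) := (𝓕 φ).integrable
  have hki1 : Integrable fun v : ℝ => |v| * ‖𝓕 (φ : ℝ → ℂ) v‖ := by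
    refine ((𝓕 φ).integrable_pow_mul volume 1).congr (.of_forall fun v => ?_)
    simp [SchwartzMap.fourier_coe]
  set k : ℝ → ℂ := 𝓕 (φ : ℝ → ℂ)
  set M₀ := ∫ v, ‖k v‖
  set M₁ := ∫ v, |v| * ‖k v‖
  have hsmooth {δ : ℝ} (hδ : 0 < δ) :
      Tendsto (fun T : ℝ => ∫ v : ℝ, P (Real.exp (-(δ * (T + v)))) * k v) atBot (𝓝 0) := by
    -- Dilating the logarithmic variable by `δ` replaces `P` by `x ↦ P (x ^ δ)`. The
    -- truncation `max x 0` makes the function vanish also at negative `x`, where the real power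
    -- takes conventional values.
    have hP' : Measurable fun x : ℝ => P (max x 0 ^ δ) := by fun_prop
    have := tendsto_integral_comp_exp_neg_add_mul_fourier (P := fun x : ℝ => P (max x 0 ^ δ)) hP'
      (fun t => hC _) (fun t ht => h0 _ ?_) (H := fun z => δ⁻¹ • H (z / δ)) ?_ (fun z hz => ?_)
      φ.continuous hφc hki
    · refine this.congr fun T => integral_congr_ae (.of_forall fun v => ?_)
      simp only
      rw [max_eq_left (Real.exp_nonneg _), ← Real.exp_mul, neg_mul, mul_comm _ δ]
    · exact Real.rpow_lt_one (le_max_right _ _) (by simp [ht]) hδ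
    · have hdiv : MapsTo (fun z : ℂ => z / δ) {z | 0 ≤ z.re} {z | 0 ≤ z.re} := fun z hz => by
        simpa using div_nonneg hz hδ.le
      exact ContinuousOn.const_smul (g := fun z : ℂ => H (z / δ)) (hH.comp (by fun_prop) hdiv) δ⁻¹
    · have h1 : mellin (fun x : ℝ => P (max x 0 ^ δ)) (-z) = mellin (fun x : ℝ => P (x ^ δ)) (-z) :=
        setIntegral_congr_fun measurableSet_Ioi fun t (ht : 0 < t) => by simp [max_eq_left ht.le]
      rw [h1, mellin_comp_rpow, abs_of_pos hδ, neg_div, hPH]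
      simpa using div_pos hz hδ
  -- Slow oscillation: the average over the scale `δ` is close to the value itself.
  have hbound {δ : ℝ} (hδ : 0 < δ) (T : ℝ) :
      ‖P (Real.exp (-(δ * T))) - ∫ v : ℝ, P (Real.exp (-(δ * (T + v)))) * k v‖ ≤
        K * δ * M₁ + η (δ * T) * M₀ := by
    have hi : Integrable fun v : ℝ => P (Real.exp (-(δ * (T + v)))) * k v :=
      hki.bdd_mul (c := C) (by fun_prop : Measurable fun v : ℝ =>
        P (Real.exp (-(δ * (T + v))))).aestronglyMeasurable (.of_forall fun v => hC _)
    rw [← mul_one (P (Real.exp (-(δ * T)))), ← hφ1, ← integral_const_mul,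
      ← integral_sub (hki.const_mul _) hi, ← integral_const_mul, ← integral_const_mul,
      ← integral_add (hki1.const_mul _) (hki.norm.const_mul _)]
    refine norm_integral_le_of_norm_le ((hki1.const_mul _).add (hki.norm.const_mul _))
      (.of_forall fun v => ?_)
    have h := hosc (δ * T) (δ * v)
    rw [← mul_add, norm_sub_rev, abs_mul, abs_of_pos hδ] at h
    calc ‖P (Real.exp (-(δ * T))) * k v - P (Real.exp (-(δ * (T + v)))) * k v‖
        = ‖P (Real.exp (-(δ * T))) - P (Real.exp (-(δ * (T + v))))‖ * ‖k v‖ := by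
          rw [← sub_mul, norm_mul]
      _ ≤ (K * (δ * |v|) + η (δ * T)) * ‖k v‖ := by gcongr
      _ = _ := by ring
  have hlog : Tendsto (fun T : ℝ => P (Real.exp (-T))) atBot (𝓝 0) := by
    rw [NormedAddGroup.tendsto_nhds_zero]
    intro ε hε
    obtain ⟨δ, hδ, hδε⟩ : ∃ δ > 0, K * δ * M₁ < ε / 3 := by
      have : Tendsto (fun δ : ℝ => K * δ * M₁) (𝓝[>] 0) (𝓝 0) := by
        have hc : Continuous fun δ : ℝ => K * δ * M₁ := by fun_prop
        simpa using (hc.tendsto 0).mono_left nhdsWithin_le_nhds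
      obtain ⟨δ, h1, h2⟩ := ((eventually_mem_nhdsWithin (a := (0 : ℝ)) (s := Ioi 0)).and
        (this.eventually (gt_mem_nhds (show (0 : ℝ) < ε / 3 by positivity)))).exists
      exact ⟨δ, h1, h2⟩
    have hT : Tendsto (fun T : ℝ => T / δ) atBot atBot := tendsto_id.atBot_div_const hδ
    have e1 := (hsmooth hδ).comp hT |>.norm
    have e2 := hη.mul_const M₀
    rw [norm_zero] at e1
    rw [zero_mul] at e2
    filter_upwards [e1.eventually (gt_mem_nhds (show (0 : ℝ) < ε / 3 by positivity)),
      e2.eventually (gt_mem_nhds (show (0 : ℝ) < ε / 3 by positivity))] with T h1 h2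
    have h3 := hbound hδ (T / δ)
    rw [mul_div_cancel₀ T hδ.ne'] at h3
    simp only [Function.comp_apply] at h1
    have h4 := norm_le_norm_sub_add (P (Real.exp (-T)))
      (∫ v : ℝ, P (Real.exp (-(δ * (T / δ + v)))) * k v)
    linarith
  refine (hlog.comp (tendsto_neg_atTop_atBot.comp Real.tendsto_log_atTop)).congr' ?_
  filter_upwards [eventually_gt_atTop 0] with x hx
  simp [Real.exp_log hx]

/-! ### Slow oscillation of summatory functions -/

/-- An upper bound for a block of the harmonic series. The factor `2`, in place of the sharp `1`,
puts the error term at the far end `M`, where it is small compared with both ends. -/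
theorem sum_Ioc_inv_le {m M : ℕ} (h : m < M) :
    ∑ n ∈ Finset.Ioc m M, (n : ℝ)⁻¹ ≤ 2 * (Real.log M - Real.log (m + 1)) + (M : ℝ)⁻¹ := by
  induction M, h using Nat.le_induction with
  | base => simp
  | succ M hM ih =>
    have hM0 : (0 : ℝ) < M := by
      have : 0 < M := by omega
      exact_mod_cast this
    rw [Finset.sum_Ioc_succ_top (by omega)]
    have h1 : 1 - ((M + 1 : ℝ) / M)⁻¹ ≤ Real.log ((M + 1) / M) :=
      Real.one_sub_inv_le_log_of_pos (by positivity)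
    rw [Real.log_div (by positivity) hM0.ne'] at h1
    have h2 : (M : ℝ)⁻¹ ≤ 2 * (1 - ((M + 1 : ℝ) / M)⁻¹) := by
      have : (1 : ℝ) ≤ M := by exact_mod_cast hM0
      rw [inv_div, one_sub_div (by positivity), add_sub_cancel_left, inv_eq_one_div, ← mul_div_assoc,
        div_le_div_iff₀ hM0 (by positivity)]
      linarith
    push_cast
    linarith

theorem norm_summatory_sub_le {c : ℕ → ℂ} (hc : ∀ n, ‖c n‖ ≤ (n : ℝ)⁻¹) {x y : ℝ} (hx : 0 < x)
    (hxy : x ≤ y) : ‖summatory c y - summatory c x‖ ≤ 2 * (Real.log y - Real.log x) + 2 / y := by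
  have hy : 0 < y := hx.trans_le hxy
  have hlog : Real.log x ≤ Real.log y := Real.log_le_log hx hxy
  rcases (Nat.floor_le_floor hxy).eq_or_lt with h | h
  · rw [summatory, summatory, h, sub_self, norm_zero]
    have : 0 ≤ 2 / y := by positivity
    linarith
  have hsub : summatory c y - summatory c x = ∑ n ∈ Finset.Ioc ⌊x⌋₊ ⌊y⌋₊, c n := by
    have := Finset.sum_Ioc_consecutive c (Nat.zero_le _) h.le
    rw [sub_eq_iff_eq_add', summatory, summatory]
    exact this.symm
  have hM : (1 : ℝ) ≤ ⌊y⌋₊ := by exact_mod_cast (Nat.zero_le _).trans_lt h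
  calc ‖summatory c y - summatory c x‖ ≤ ∑ n ∈ Finset.Ioc ⌊x⌋₊ ⌊y⌋₊, (n : ℝ)⁻¹ := by
        rw [hsub]
        exact norm_sum_le_of_le _ fun n _ => hc n
    _ ≤ 2 * (Real.log ⌊y⌋₊ - Real.log (⌊x⌋₊ + 1)) + (⌊y⌋₊ : ℝ)⁻¹ := sum_Ioc_inv_le h
    _ ≤ 2 * (Real.log y - Real.log x) + 2 / y := by
      have h1 : Real.log ⌊y⌋₊ ≤ Real.log y :=
        Real.log_le_log (by linarith) (Nat.floor_le hy.le)
      have h2 : Real.log x ≤ Real.log (⌊x⌋₊ + 1) :=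
        Real.log_le_log hx (Nat.lt_floor_add_one x).le
      have h3 : (⌊y⌋₊ : ℝ)⁻¹ ≤ 2 / y := by
        rw [inv_eq_one_div, div_le_div_iff₀ (by linarith) hy]
        linarith [Nat.lt_floor_add_one y]
      linarith

/-- Summatory functions of coefficients `O(1 / n)` oscillate slowly on the logarithmic scale. -/
theorem norm_summatory_exp_sub_le {c : ℕ → ℂ} (hc : ∀ n, ‖c n‖ ≤ (n : ℝ)⁻¹) (T u : ℝ) :
    ‖summatory c (Real.exp (-(T + u))) - summatory c (Real.exp (-T))‖ ≤
      2 * |u| + 2 * Real.exp T := by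
  rcases le_total u 0 with hu | hu
  · have h := norm_summatory_sub_le hc (Real.exp_pos (-T))
      (Real.exp_le_exp.mpr (show -T ≤ -(T + u) by linarith))
    rw [Real.log_exp, Real.log_exp, div_eq_mul_inv, ← Real.exp_neg, neg_neg] at h
    have : Real.exp (T + u) ≤ Real.exp T := Real.exp_le_exp.mpr (by linarith)
    rw [abs_of_nonpos hu]
    linarith
  · have h := norm_summatory_sub_le hc (Real.exp_pos (-(T + u)))
      (Real.exp_le_exp.mpr (show -(T + u) ≤ -T by linarith))
    rw [Real.log_exp, Real.log_exp, div_eq_mul_inv, ← Real.exp_neg, neg_neg, norm_sub_rev] at h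
    rw [abs_of_nonneg hu]
    linarith

/-! ### The Liouville function -/

/-- `∑ d ∣ n, λ(d)` is the indicator of squares; only these bounds are needed. -/
theorem liouville_mul_zeta_mem_Icc (n : ℕ) :
    (liouville * (ζ : ArithmeticFunction ℤ)) n ∈ Icc (0 : ℤ) 1 := by
  have hm : IsMultiplicative (liouville * (ζ : ArithmeticFunction ℤ)) :=
    isMultiplicative_liouville.mul isMultiplicative_zeta.natCast
  induction n using Nat.recOnPrimeCoprime with
  | zero => simp
  | prime_pow p k hp =>
    rw [coe_mul_zeta_apply, Nat.sum_divisors_prime_pow hp]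
    have (i : ℕ) : liouville (p ^ i) = (-1) ^ i := by
      rw [liouville_apply (pow_ne_zero _ hp.ne_zero), cardFactors_apply_prime_pow hp]
    rw [Finset.sum_congr rfl fun i _ => this i, neg_one_geom_sum]
    split_ifs <;> simp
  | coprime a b ha hb hab iha ihb =>
    rw [hm.map_mul_of_coprime hab]
    exact ⟨mul_nonneg iha.1 ihb.1, mul_le_one₀ iha.2 ihb.1 ihb.2⟩

theorem abs_liouville_le_one (n : ℕ) : |liouville n| ≤ 1 := by
  rcases eq_or_ne n 0 with rfl | hn
  · simp
  · simp [liouville_apply hn]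

/-- The elementary bound behind the Tauberian argument: `N ∑ λ(n) / n` differs by at most `N` from
`∑ λ(n) ⌊N / n⌋ = ∑ (λ * 1)(n)`, which lies between `0` and `N`. -/
theorem abs_sum_liouville_div_le (N : ℕ) :
    |∑ n ∈ Finset.Icc 1 N, (liouville n : ℝ) / n| ≤ 2 := by
  rcases N.eq_zero_or_pos with rfl | hN
  · simp
  have hN' : (0 : ℝ) < N := by exact_mod_cast hN
  have hA := sum_Ioc_mul_zeta_eq_sum liouville N
  have hA0 : 0 ≤ ∑ n ∈ Finset.Ioc 0 N, (liouville * (ζ : ArithmeticFunction ℤ)) n :=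
    Finset.sum_nonneg fun n _ => (liouville_mul_zeta_mem_Icc n).1
  have hA1 : ∑ n ∈ Finset.Ioc 0 N, (liouville * (ζ : ArithmeticFunction ℤ)) n ≤ N := by
    refine (Finset.sum_le_card_nsmul _ _ 1 fun n _ => (liouville_mul_zeta_mem_Icc n).2).trans ?_
    simp
  rw [hA] at hA0 hA1
  set B : ℝ := ∑ n ∈ Finset.Ioc 0 N, (liouville n : ℝ) * ((N / n : ℕ) : ℝ) with hB
  have hB' : B = ((∑ n ∈ Finset.Ioc 0 N, liouville n * ((N / n : ℕ) : ℤ) : ℤ) : ℝ) := by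
    rw [hB]
    push_cast
    rfl
  have hB0 : 0 ≤ B := by rw [hB']; exact_mod_cast hA0
  have hB1 : B ≤ N := by rw [hB']; exact_mod_cast hA1
  have hdiff : |N * ∑ n ∈ Finset.Ioc 0 N, (liouville n : ℝ) / n - B| ≤ N := by
    rw [Finset.mul_sum, hB, ← Finset.sum_sub_distrib]
    refine (Finset.abs_sum_le_sum_abs _ _).trans ?_
    refine (Finset.sum_le_card_nsmul _ _ 1 fun n hn => ?_).trans (by simp)
    have hn0 : (0 : ℝ) < n := by exact_mod_cast (Finset.mem_Ioc.mp hn).1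
    have h1 : |(liouville n : ℝ)| ≤ 1 := by exact_mod_cast abs_liouville_le_one n
    have h2 : |(N : ℝ) / n - ((N / n : ℕ) : ℝ)| ≤ 1 := by
      rw [← Nat.floor_div_eq_div (K := ℝ), abs_le]
      have h3 := Nat.floor_le (show 0 ≤ (N : ℝ) / n by positivity)
      have h4 := Nat.lt_floor_add_one ((N : ℝ) / n)
      constructor <;> linarith
    calc |(N : ℝ) * ((liouville n : ℝ) / n) - liouville n * ((N / n : ℕ) : ℝ)|
        = |(liouville n : ℝ)| * |(N : ℝ) / n - ((N / n : ℕ) : ℝ)| := by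
          rw [← abs_mul]
          congr 1
          ring
      _ ≤ 1 := mul_le_one₀ h1 (abs_nonneg _) h2
  change |∑ n ∈ Finset.Ioc 0 N, (liouville n : ℝ) / n| ≤ 2
  rw [abs_le] at hdiff ⊢
  constructor <;> nlinarith

theorem LSeriesSummable_liouville {s : ℂ} (hs : 1 < s.re) :
    LSeriesSummable (fun n => (liouville n : ℂ)) s :=
  LSeriesSummable_of_bounded_of_one_lt_re (m := 1) (fun n _ => by
    rw [Complex.norm_intCast]
    exact_mod_cast abs_liouville_le_one n) hs

/-- Comparison of Euler products: `(1 + p⁻ˢ)⁻¹ (1 - p⁻ˢ)⁻¹ = (1 - p⁻²ˢ)⁻¹`. -/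
theorem LSeries_liouville_mul_riemannZeta {s : ℂ} (hs : 1 < s.re) :
    LSeries (fun n => (liouville n : ℂ)) s * riemannZeta s = riemannZeta (2 * s) := by
  let f : ℕ →*₀ ℂ :=
    { toFun := fun n => (liouville n : ℂ) * (n : ℂ) ^ (-s)
      map_zero' := by simp
      map_one' := by simp [liouville_apply_one]
      map_mul' := fun m n => by
        rw [liouville_apply_mul, Nat.cast_mul, Complex.natCast_mul_natCast_cpow]
        push_cast
        ring }
  have hterm : LSeries.term (fun n => (liouville n : ℂ)) s = f := by
    ext n
    exact LSeries.term_def₀ (by simp) s n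
  have hf : Summable fun n => ‖f n‖ := by
    have := (LSeriesSummable_liouville hs).norm
    rwa [hterm] at this
  have h1 := EulerProduct.eulerProduct_completely_multiplicative_hasProd hf
  have h2 := h1.mul (riemannZeta_eulerProduct_hasProd hs)
  have h3 := riemannZeta_eulerProduct_hasProd (s := 2 * s) (by simp; linarith)
  rw [LSeries, hterm]
  refine h2.unique ?_
  convert! h3 using 2 with p
  have hp : f p = -(p : ℂ) ^ (-s) := by
    change (liouville (p : ℕ) : ℂ) * (p : ℂ) ^ (-s) = _
    rw [liouville_apply p.prop.ne_zero, cardFactors_apply_prime p.prop]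
    simp
  rw [hp, ← mul_inv, show -(2 * s) = (2 : ℕ) * -s by push_cast; ring, Complex.cpow_nat_mul]
  ring

/-- The function `z ↦ z ζ(1 + z)`, with its limit `1` as value at `0`. -/
noncomputable def mulZetaOneAdd : ℂ → ℂ := Function.update (fun z => z * riemannZeta (1 + z)) 0 1

theorem mulZetaOneAdd_of_ne_zero {z : ℂ} (hz : z ≠ 0) :
    mulZetaOneAdd z = z * riemannZeta (1 + z) := Function.update_of_ne hz _ _

theorem continuous_mulZetaOneAdd : Continuous mulZetaOneAdd := by
  rw [continuous_iff_continuousAt]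
  intro z
  rcases eq_or_ne z 0 with rfl | hz
  · rw [mulZetaOneAdd, continuousAt_update_same]
    have h : Tendsto (fun z : ℂ => 1 + z) (𝓝[≠] 0) (𝓝[≠] 1) := by
      refine tendsto_nhdsWithin_of_tendsto_nhds_of_eventually_within _ ?_ ?_
      · have : Continuous fun z : ℂ => 1 + z := by fun_prop
        simpa using (this.tendsto 0).mono_left nhdsWithin_le_nhds
      · filter_upwards [self_mem_nhdsWithin] with z hz
        simpa using hz
    simpa [Function.comp_def] using riemannZeta_residue_one.comp h
  · rw [mulZetaOneAdd, continuousAt_update_of_ne hz]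
    refine continuousAt_id.mul ?_
    exact ContinuousAt.comp (f := fun z : ℂ => 1 + z)
      (differentiableAt_riemannZeta (by simpa using hz)).continuousAt (by fun_prop)

theorem mulZetaOneAdd_ne_zero {z : ℂ} (hz : 0 ≤ z.re) : mulZetaOneAdd z ≠ 0 := by
  rcases eq_or_ne z 0 with rfl | h
  · simp [mulZetaOneAdd]
  · rw [mulZetaOneAdd_of_ne_zero h]
    exact mul_ne_zero h (riemannZeta_ne_zero_of_one_le_re (by simpa using hz))

theorem continuousOn_zeta_div_mulZetaOneAdd :
    ContinuousOn (fun z : ℂ => riemannZeta (2 * (1 + z)) / mulZetaOneAdd z) {z | 0 ≤ z.re} := by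
  refine ContinuousOn.div (fun z hz => ?_) continuous_mulZetaOneAdd.continuousOn
    fun z hz => mulZetaOneAdd_ne_zero hz
  have hz' : 0 ≤ z.re := hz
  have h1 : 2 * (1 + z) ≠ 1 := fun h => by
    have := congrArg Complex.re h
    simp at this
    linarith
  exact (ContinuousAt.comp (f := fun z : ℂ => 2 * (1 + z))
    (differentiableAt_riemannZeta h1).continuousAt (by fun_prop)).continuousWithinAt

/-- A form of the prime number theorem: `∑ λ(n) / n = 0`. -/
theorem tendsto_sum_liouville_div :
    Tendsto (fun N : ℕ => ∑ n ∈ Finset.Icc 1 N, (liouville n : ℂ) / n) atTop (𝓝 0) := by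
  set c : ℕ → ℂ := fun n => (liouville n : ℂ) / n with hcdef
  have hc0 : c 0 = 0 := by simp [hcdef]
  have hC (n : ℕ) : ‖∑ k ∈ Finset.Icc 1 n, c k‖ ≤ 2 := by
    have h : ∑ k ∈ Finset.Icc 1 n, c k = ((∑ k ∈ Finset.Icc 1 n, (liouville k : ℝ) / k : ℝ) : ℂ) := by
      push_cast
      rfl
    rw [h, Complex.norm_real]
    exact abs_sum_liouville_div_le n
  have hcn (n : ℕ) : ‖c n‖ ≤ (n : ℝ)⁻¹ := by
    rw [hcdef, norm_div, Complex.norm_natCast, Complex.norm_intCast, div_eq_mul_inv]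
    exact mul_le_of_le_one_left (by positivity) (by exact_mod_cast abs_liouville_le_one n)
  have hterm {z : ℂ} : LSeries.term c z = LSeries.term (fun n => (liouville n : ℂ)) (1 + z) := by
    ext n
    rcases eq_or_ne n 0 with rfl | hn
    · simp
    · rw [LSeries.term_of_ne_zero hn, LSeries.term_of_ne_zero hn,
        Complex.cpow_add _ _ (by exact_mod_cast hn), Complex.cpow_one, div_div]
  have hmellin (z : ℂ) (hz : 0 < z.re) : mellin (summatory c) (-z) =
      riemannZeta (2 * (1 + z)) / mulZetaOneAdd z := by
    have hz0 : z ≠ 0 := by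
      rintro rfl
      simp at hz
    have hz1 : 1 < (1 + z).re := by simpa using hz
    have hS : LSeriesSummable c z := by
      rw [LSeriesSummable, hterm]
      exact LSeriesSummable_liouville hz1
    have h1 := LSeries_eq_mul_mellin_summatory hc0 hC hz hS
    have h2 := LSeries_liouville_mul_riemannZeta hz1
    rw [LSeries, ← hterm, ← LSeries, h1] at h2
    rw [eq_div_iff (mulZetaOneAdd_ne_zero hz.le), mulZetaOneAdd_of_ne_zero hz0, ← h2]
    ring
  have hη : Tendsto (fun T : ℝ => 2 * Real.exp T) atBot (𝓝 0) := by
    simpa using Real.tendsto_exp_atBot.const_mul 2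
  have h := tendsto_zero_of_mellin_continuousOn (measurable_summatory c) (norm_summatory_le hC)
    (fun t => summatory_of_lt_one c) continuousOn_zeta_div_mulZetaOneAdd hmellin hη
    (norm_summatory_exp_sub_le hcn)
  refine (h.comp tendsto_natCast_atTop_atTop).congr fun N => ?_
  simp [summatory]

/-! ### Completely multiplicative functions with sum zero -/

theorem IsCMO.of_nat {f : ℕ → ℂ} (h1 : f 1 = 1) (hmul : ∀ a b : ℕ, f (a * b) = f a * f b)
    (hsum : Tendsto (fun N : ℕ => ∑ k ∈ Finset.Icc 1 N, f k) atTop (𝓝 0)) :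
    IsCMO (fun n : ℕ+ => f n) where
  ne_zero h := by simpa [h1] using congrFun h 1
  map_mul a b := by simpa using hmul a b
  tendsto_sum := hsum.congr fun N => by
    rw [Finset.range_eq_Ico]
    exact (Finset.sum_Ico_add' f 0 N 1).symm

theorem mainTheorem6 :
    IsCMO (fun n : ℕ+ => ((ArithmeticFunction.liouville (n : ℕ) : ℤ) : ℂ) / ((n : ℕ) : ℂ)) ∧
    ∀ (q : ℕ) [NeZero q] (χ : DirichletCharacter ℂ q), χ ≠ 1 →
      ∀ ρ : ℂ, 0 < ρ.re → DirichletCharacter.LFunction χ ρ = 0 →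
        IsCMO (fun n : ℕ+ => χ (((n : ℕ) : ZMod q)) / ((n : ℕ) : ℂ) ^ ρ) := by
  constructor
  · refine IsCMO.of_nat (f := fun n => (liouville n : ℂ) / n) (by simp [liouville_apply_one])
      (fun a b => ?_) tendsto_sum_liouville_div
    rw [liouville_apply_mul]
    push_cast
    ring
  · intro q _ χ hχ ρ hρ h0
    refine IsCMO.of_nat (f := fun n : ℕ => χ (n : ZMod q) / (n : ℂ) ^ ρ) (by simp)
      (fun a b => ?_) ?_
    · rw [Nat.cast_mul, Nat.cast_mul, map_mul, Complex.natCast_mul_natCast_cpow, mul_div_mul_comm]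
    · have h := tendsto_sum_dirichletCharacter_mul_cpow hχ hρ
      rw [h0] at h
      simpa only [Complex.cpow_neg, ← div_eq_mul_inv] using h
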